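/- Let $n\ge 2$, let $J=\mathrm{diag}(1,\dots,1,-1)$ be of size $n+1$, and let $O(n,1)=\{A\in GL(n+1,\mathbb R): JA^{T}J=A^{-1}\}$ be the Lorentz group, with Lie algebra $\mathfrak o(n,1)=\{X : JX^{T}J=-X\}$, Killing form $B(X,Y)=\operatorname{tr}(\operatorname{ad}X\circ\operatorname{ad}Y)$ and Cartan involution $\theta(X)=-X^{T}$. Let $g_0$ be the left-invariant Riemannian metric on $O(n,1)$ induced by the inner product $\langle X,Y\rangle=-B(X,\theta Y)$ on $\mathfrak o(n,1)$, and let $\tilde g_0=\frac{1}{2(n-1)}\,g_0$. Let $\nabla$ be the Levi-Civita connection of $\tilde g_0$ and $R(U,V)W=\nabla_U\nabla_VW-\nabla_V\nabla_UW-\nabla_{[U,V]}W$ its curvature tensor. Then the sectional curvature of $O(n,1)$ with respect to $\tilde g_0$ is bounded above by $\frac{n^2+43n}{8}$: at every point of $O(n,1)$ and for all linearly independent left-invariant vector fields $X,Y$ (which span every tangent plane), $$K(X,Y)=\frac{\tilde g_0(R(X,Y)Y,X)}{\tilde g_0(X,X)\,\tilde g_0(Y,Y)-\tilde g_0(X,Y)^2}\;\le\;\frac{n^2+43n}{8}.$$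 -/

import Mathlib

open scoped Matrix Matrix.Norms.Operator ContDiff

noncomputable section

namespace Lorentz

/-! ### The group `O(n,1)` and its Lie algebra -/

/-- Real `(n+1) × (n+1)` matrices; the last coordinate is indexed by `Unit`. -/
abbrev Mat (n : ℕ) : Type := Matrix (Fin n ⊕ Unit) (Fin n ⊕ Unit) ℝ

/-- `J = diag(1, …, 1, -1)`. -/
abbrev J (n : ℕ) : Mat n := LieAlgebra.Orthogonal.indefiniteDiagonal (Fin n) Unit ℝ

lemma J_mul_J (n : ℕ) : J n * J n = 1 := by
  unfold J LieAlgebra.Orthogonal.indefiniteDiagonal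
  rw [Matrix.diagonal_mul_diagonal, ← Matrix.diagonal_one]
  congr 1
  funext i
  rcases i with i | i <;> simp

lemma J_transpose (n : ℕ) : (J n)ᵀ = J n := Matrix.diagonal_transpose _

/-- `O(n,1) = {A ∈ GL(n+1,ℝ) : J Aᵀ J = A⁻¹}`. -/
def O (n : ℕ) : Subgroup (GL (Fin n ⊕ Unit) ℝ) where
  carrier := {A | J n * (A : Mat n)ᵀ * J n = ((A⁻¹ : GL (Fin n ⊕ Unit) ℝ) : Mat n)}
  one_mem' := by simp [J_mul_J]
  mul_mem' := by
    intro A B hA hB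
    simp only [Set.mem_ofPred_eq] at hA hB ⊢
    rw [mul_inv_rev, Units.val_mul, Units.val_mul, Matrix.transpose_mul, ← hA, ← hB]
    calc J n * ((B : Mat n)ᵀ * (A : Mat n)ᵀ) * J n
        = J n * (B : Mat n)ᵀ * 1 * (A : Mat n)ᵀ * J n := by noncomm_ring
      _ = _ := by rw [← J_mul_J]; noncomm_ring
  inv_mem' := by
    intro A hA
    simp only [Set.mem_ofPred_eq] at hA ⊢
    rw [← hA, inv_inv, Matrix.transpose_mul, Matrix.transpose_mul, J_transpose,
      Matrix.transpose_transpose]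
    calc J n * (J n * ((A : Mat n) * J n)) * J n
        = (J n * J n) * (A : Mat n) * (J n * J n) := by noncomm_ring
      _ = _ := by rw [J_mul_J]; simp

/-- The matrix of an element of `O(n,1)`. -/
def toMat {n : ℕ} (g : O n) : Mat n := ((g : GL (Fin n ⊕ Unit) ℝ) : Mat n)

/-- The Lie algebra `𝔬(n,1)`: the matrices `X` with `Xᵀ J = - J X`, with the commutator as
bracket. -/
abbrev 𝔬 (n : ℕ) := LieAlgebra.Orthogonal.so' (Fin n) Unit ℝ

lemma mem_𝔬 {n : ℕ} {X : Mat n} : X ∈ 𝔬 n ↔ J n * Xᵀ * J n = -X := by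
  have h : X ∈ 𝔬 n ↔ Xᵀ * J n = J n * -X := by
    change X ∈ skewAdjointMatricesSubmodule _ ↔ _
    rw [mem_skewAdjointMatricesSubmodule]
    rfl
  rw [h]
  constructor
  · intro h
    rw [mul_assoc, h, ← mul_assoc, J_mul_J, one_mul]
  · intro h
    rw [← h, ← mul_assoc, ← mul_assoc, J_mul_J, one_mul]

lemma toMat_mul {n : ℕ} (g h : O n) : toMat (g * h) = toMat g * toMat h := rfl

lemma toMat_inv {n : ℕ} (g : O n) : toMat g⁻¹ = J n * (toMat g)ᵀ * J n := g.2.symm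

lemma toMat_inv_mul {n : ℕ} (g : O n) : toMat g⁻¹ * toMat g = 1 := by
  rw [← toMat_mul, inv_mul_cancel]; rfl

lemma toMat_mul_inv {n : ℕ} (g : O n) : toMat g * toMat g⁻¹ = 1 := by
  rw [← toMat_mul, mul_inv_cancel]; rfl

/-- The exponential map `𝔬(n,1) → O(n,1)`, given by the matrix exponential. -/
def expO {n : ℕ} (X : 𝔬 n) : O n :=
  ⟨⟨NormedSpace.exp (X : Mat n), NormedSpace.exp (-(X : Mat n)),
      by rw [← Matrix.exp_add_of_commute _ _ (Commute.neg_right (Commute.refl (X : Mat n))), add_neg_cancel,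
        NormedSpace.exp_zero],
      by rw [← Matrix.exp_add_of_commute _ _ (Commute.neg_left (Commute.refl (X : Mat n))), neg_add_cancel,
        NormedSpace.exp_zero]⟩, by
    have hJ : (J n)⁻¹ = J n := Matrix.inv_eq_right_inv (J_mul_J n)
    have hu : IsUnit (J n) := ⟨⟨J n, J n, J_mul_J n, J_mul_J n⟩, rfl⟩
    have h := Matrix.exp_conj (J n) ((X : Mat n)ᵀ) hu
    rw [hJ, mem_𝔬.1 X.2, Matrix.exp_transpose] at h
    exact h.symm⟩

lemma toMat_expO {n : ℕ} (X : 𝔬 n) : toMat (expO X) = NormedSpace.exp (X : Mat n) := rfl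

/-- `𝔬(n,1)` is the Lie algebra of the matrix group `O(n,1)`: it consists of the matrices `X`
with `e^{tX} ∈ O(n,1)` for all real `t`. -/
theorem mem_𝔬_iff_exp {n : ℕ} (X : Mat n) :
    X ∈ 𝔬 n ↔ ∀ t : ℝ, ∃ g : O n, toMat g = NormedSpace.exp (t • X) := by
  constructor
  · intro h t
    exact ⟨expO (t • ⟨X, h⟩), rfl⟩
  · intro h
    have key : ∀ t : ℝ, J n * (NormedSpace.exp (t • X))ᵀ * J n * NormedSpace.exp (t • X) = 1 := by
      intro t
      obtain ⟨g, hg⟩ := h t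
      rw [← hg, ← toMat_inv, toMat_inv_mul]
    have hd : HasDerivAt (fun t : ℝ => NormedSpace.exp (t • X)) X 0 := by
      have h := hasDerivAt_exp_smul_const (𝕂 := ℝ) X 0
      rw [zero_smul, NormedSpace.exp_zero, one_mul] at h
      exact h
    let T : Mat n →L[ℝ] Mat n :=
      LinearMap.toContinuousLinearMap (Matrix.transposeLinearEquiv _ _ ℝ ℝ).toLinearMap
    have hT : HasDerivAt (fun t : ℝ => (NormedSpace.exp (t • X))ᵀ) Xᵀ 0 :=
      T.hasFDerivAt.comp_hasDerivAt 0 hd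
    have h1 := ((hT.const_mul (J n)).mul_const (J n)).mul hd
    have h2 := (hasDerivAt_const (0 : ℝ) (1 : Mat n)).congr_of_eventuallyEq
      (Filter.Eventually.of_forall key)
    have h3 := h1.unique h2
    simp only [zero_smul, NormedSpace.exp_zero, Matrix.transpose_one, mul_one, J_mul_J,
      one_mul] at h3
    exact mem_𝔬.2 (eq_neg_of_add_eq_zero_left h3)

/-! ### The canonical metric -/

/-- The Cartan involution `θ(X) = -Xᵀ` of `𝔬(n,1)`. -/
def θ {n : ℕ} (X : 𝔬 n) : 𝔬 n :=
  ⟨-(X : Mat n)ᵀ, by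
    have h := congrArg Matrix.transpose (mem_𝔬.1 X.2)
    rw [Matrix.transpose_mul, Matrix.transpose_mul, J_transpose, Matrix.transpose_transpose] at h
    rw [mem_𝔬, Matrix.transpose_neg, Matrix.transpose_transpose, mul_neg, neg_mul, mul_assoc, h,
      Matrix.transpose_neg]⟩

/-- The inner product `B_θ(X,Y) = -B(X, θ Y)` on `𝔬(n,1)`, where `B` is the Killing form. -/
def canonicalInner {n : ℕ} (X Y : 𝔬 n) : ℝ := -killingForm ℝ (𝔬 n) X (θ Y)

/-- The rescaled inner product `(1 / (2(n-1))) B_θ` on `𝔬(n,1)`. -/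
def rescaledInner {n : ℕ} (X Y : 𝔬 n) : ℝ := 1 / (2 * ((n : ℝ) - 1)) * canonicalInner X Y

/-! ### Smooth functions and vector fields on `O(n,1)` -/

/-- Smoothness of a function on the embedded submanifold `O(n,1)` of the space of matrices:
locally, it is the restriction of a smooth function of matrices. -/
def IsSmooth {n : ℕ} {E : Type*} [NormedAddCommGroup E] [NormedSpace ℝ E] (f : O n → E) : Prop :=
  ∀ g : O n, ∃ U : Set (Mat n), IsOpen U ∧ toMat g ∈ U ∧
    ∃ F : Mat n → E, ContDiffOn ℝ ∞ F U ∧ ∀ h : O n, toMat h ∈ U → F (toMat h) = f h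

lemma IsSmooth.map₂ {n : ℕ} {E F G : Type*} [NormedAddCommGroup E] [NormedSpace ℝ E]
    [NormedAddCommGroup F] [NormedSpace ℝ F] [NormedAddCommGroup G] [NormedSpace ℝ G]
    {f : O n → E} {k : O n → F} (hf : IsSmooth f) (hk : IsSmooth k) {b : E × F → G}
    (hb : ContDiff ℝ ∞ b) : IsSmooth (fun g => b (f g, k g)) := by
  intro g
  obtain ⟨U, hU, hgU, F, hF, hFf⟩ := hf g
  obtain ⟨V, hV, hgV, K, hK, hKk⟩ := hk g
  refine ⟨U ∩ V, hU.inter hV, ⟨hgU, hgV⟩, fun A => b (F A, K A), ?_, ?_⟩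
  · exact hb.comp_contDiffOn
      ((hF.mono Set.inter_subset_left).prodMk (hK.mono Set.inter_subset_right))
  · intro h hh
    simp only [hFf h hh.1, hKk h hh.2]

lemma isSmooth_of_contDiff {n : ℕ} {E : Type*} [NormedAddCommGroup E] [NormedSpace ℝ E]
    {F : Mat n → E} (hF : ContDiff ℝ ∞ F) : IsSmooth (fun g : O n => F (toMat g)) :=
  fun _ => ⟨Set.univ, isOpen_univ, trivial, F, hF.contDiffOn, fun _ _ => rfl⟩

lemma IsSmooth.comp {n : ℕ} {E F : Type*} [NormedAddCommGroup E] [NormedSpace ℝ E]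
    [NormedAddCommGroup F] [NormedSpace ℝ F] {f : O n → E} (hf : IsSmooth f) {b : E → F}
    (hb : ContDiff ℝ ∞ b) : IsSmooth (fun g => b (f g)) :=
  hf.map₂ hf (hb.comp contDiff_fst)

lemma IsSmooth.add {n : ℕ} {E : Type*} [NormedAddCommGroup E] [NormedSpace ℝ E] {f k : O n → E}
    (hf : IsSmooth f) (hk : IsSmooth k) : IsSmooth (fun g => f g + k g) :=
  hf.map₂ hk (contDiff_fst.add contDiff_snd)

lemma IsSmooth.sub {n : ℕ} {E : Type*} [NormedAddCommGroup E] [NormedSpace ℝ E] {f k : O n → E}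
    (hf : IsSmooth f) (hk : IsSmooth k) : IsSmooth (fun g => f g - k g) :=
  hf.map₂ hk (contDiff_fst.sub contDiff_snd)

lemma IsSmooth.smul {n : ℕ} {E : Type*} [NormedAddCommGroup E] [NormedSpace ℝ E] {f : O n → ℝ}
    {k : O n → E} (hf : IsSmooth f) (hk : IsSmooth k) : IsSmooth (fun g => f g • k g) :=
  hf.map₂ hk (contDiff_fst.smul contDiff_snd)

lemma IsSmooth.mul {n : ℕ} {f k : O n → Mat n} (hf : IsSmooth f) (hk : IsSmooth k) :
    IsSmooth (fun g => f g * k g) :=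
  hf.map₂ hk (contDiff_fst.mul contDiff_snd)

/-- The tangent space of `O(n,1)` at `g`, which is `g 𝔬(n,1)`, as a space of matrices. -/
def tangentSpace {n : ℕ} (g : O n) : Submodule ℝ (Mat n) where
  carrier := {W | toMat g⁻¹ * W ∈ 𝔬 n}
  add_mem' := by
    intro A B hA hB
    rw [Set.mem_ofPred_eq] at hA hB ⊢
    rw [mul_add]
    exact add_mem hA hB
  zero_mem' := by
    rw [Set.mem_ofPred_eq, mul_zero]
    exact zero_mem _
  smul_mem' := by
    intro c A hA
    rw [Set.mem_ofPred_eq] at hA ⊢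
    rw [mul_smul_comm]
    exact SMulMemClass.smul_mem c hA

/-- The inclusion of `𝔬(n,1)` into the space of matrices. -/
def incl (n : ℕ) : 𝔬 n →ₗ[ℝ] Mat n where
  toFun X := X
  map_add' _ _ := rfl
  map_smul' _ _ := rfl

/-- The smooth functions `O(n,1) → ℝ`. -/
structure SmoothFunction (n : ℕ) where
  toFun : O n → ℝ
  smooth : IsSmooth toFun

/-- The real vector space of smooth vector fields on `O(n,1)`, as matrix-valued functions that are
everywhere tangent. -/
def vectorFields (n : ℕ) : Submodule ℝ (O n → Mat n) where
  carrier := {V | IsSmooth V ∧ ∀ g, V g ∈ tangentSpace g}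
  add_mem' := fun hU hV => ⟨hU.1.add hV.1, fun g => add_mem (hU.2 g) (hV.2 g)⟩
  zero_mem' := ⟨isSmooth_of_contDiff contDiff_const, fun _ => zero_mem _⟩
  smul_mem' := fun c _ hU =>
    ⟨hU.1.comp (contDiff_const_smul c), fun g => Submodule.smul_mem _ c (hU.2 g)⟩

/-- The smooth vector fields on `O(n,1)`. -/
abbrev VectorField (n : ℕ) : Type := vectorFields n

/-- The product `f V` of a vector field with a smooth function. -/
def VectorField.fsmul {n : ℕ} (f : SmoothFunction n) (V : VectorField n) : VectorField n :=
  ⟨fun g => f.1 g • V.1 g, f.2.smul V.2.1, fun g => Submodule.smul_mem _ _ (V.2.2 g)⟩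

/-- The element `g⁻¹ V(g)` of `𝔬(n,1)`. -/
def VectorField.pull {n : ℕ} (V : VectorField n) (g : O n) : 𝔬 n :=
  ⟨toMat g⁻¹ * V.1 g, V.2.2 g⟩

/-- The left-invariant vector field `g ↦ g X` of `X ∈ 𝔬(n,1)`. -/
def leftInvariant {n : ℕ} (X : 𝔬 n) : VectorField n :=
  ⟨fun g => toMat g * (X : Mat n),
    isSmooth_of_contDiff (F := fun A : Mat n => A * (X : Mat n)) (contDiff_id.mul contDiff_const),
    fun g => by
      change toMat g⁻¹ * (toMat g * (X : Mat n)) ∈ 𝔬 n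
      rw [← mul_assoc, toMat_inv_mul, one_mul]
      exact X.2⟩

lemma pull_leftInvariant {n : ℕ} (X : 𝔬 n) (g : O n) : (leftInvariant X).pull g = X := by
  apply Subtype.ext
  change toMat g⁻¹ * (toMat g * (X : Mat n)) = X
  rw [← mul_assoc, toMat_inv_mul, one_mul]

/-- The derivative `U f` of a function `f` along a vector field `U`: at `g`, it is the derivative
at `t = 0` of `f` along the curve `t ↦ g exp(t g⁻¹ U(g))`, whose velocity at `t = 0` is `U(g)`. -/
def dirDeriv {n : ℕ} {E : Type*} [NormedAddCommGroup E] [NormedSpace ℝ E] (U : VectorField n)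
    (f : O n → E) (g : O n) : E :=
  deriv (fun t : ℝ => f (g * expO (t • U.pull g))) 0

lemma hasDerivAt_curve {n : ℕ} (g : O n) (X : 𝔬 n) :
    HasDerivAt (fun t : ℝ => toMat (g * expO (t • X))) (toMat g * (X : Mat n)) 0 := by
  have hd : HasDerivAt (fun t : ℝ => NormedSpace.exp (t • (X : Mat n))) (X : Mat n) 0 := by
    have h := hasDerivAt_exp_smul_const (𝕂 := ℝ) (X : Mat n) 0
    rw [zero_smul, NormedSpace.exp_zero, one_mul] at h
    exact h
  exact hd.const_mul (toMat g)

lemma expO_zero_smul {n : ℕ} (g : O n) (X : 𝔬 n) : g * expO ((0 : ℝ) • X) = g := by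
  have : expO ((0 : ℝ) • X) = 1 := by
    apply Subtype.ext
    apply Units.ext
    change NormedSpace.exp ((0 : ℝ) • (X : Mat n)) = 1
    rw [zero_smul, NormedSpace.exp_zero]
  rw [this, mul_one]

lemma toMat_mul_pull {n : ℕ} (U : VectorField n) (g : O n) :
    toMat g * (U.pull g : Mat n) = U.1 g := by
  change toMat g * (toMat g⁻¹ * U.1 g) = _
  rw [← mul_assoc, toMat_mul_inv, one_mul]

lemma hasDerivAt_of_extension {n : ℕ} {E : Type*} [NormedAddCommGroup E] [NormedSpace ℝ E]
    (U : VectorField n) {f : O n → E} {g : O n} {S : Set (Mat n)} (hS : IsOpen S)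
    (hg : toMat g ∈ S) {F : Mat n → E} (hF : ContDiffOn ℝ ∞ F S)
    (hFf : ∀ h : O n, toMat h ∈ S → F (toMat h) = f h) :
    HasDerivAt (fun t : ℝ => f (g * expO (t • U.pull g))) (fderiv ℝ F (toMat g) (U.1 g)) 0 := by
  have hc := hasDerivAt_curve g (U.pull g)
  rw [toMat_mul_pull] at hc
  have hFd : HasFDerivAt F (fderiv ℝ F (toMat g)) (toMat (g * expO ((0 : ℝ) • U.pull g))) := by
    rw [expO_zero_smul]
    exact ((hF.contDiffAt (hS.mem_nhds hg)).differentiableAt (by simp)).hasFDerivAt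
  refine (hFd.comp_hasDerivAt (0 : ℝ) hc).congr_of_eventuallyEq ?_
  have hev : ∀ᶠ t : ℝ in nhds 0, toMat (g * expO (t • U.pull g)) ∈ S := by
    apply hc.continuousAt
    beta_reduce
    rw [expO_zero_smul]
    exact hS.mem_nhds hg
  filter_upwards [hev] with t ht
  exact (hFf _ ht).symm

lemma IsSmooth.hasDerivAt {n : ℕ} {E : Type*} [NormedAddCommGroup E] [NormedSpace ℝ E]
    {f : O n → E} (hf : IsSmooth f) (U : VectorField n) (g : O n) :
    HasDerivAt (fun t : ℝ => f (g * expO (t • U.pull g))) (dirDeriv U f g) 0 := by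
  obtain ⟨S, hS, hg, F, hF, hFf⟩ := hf g
  exact (hasDerivAt_of_extension U hS hg hF hFf).differentiableAt.hasDerivAt

lemma IsSmooth.dirDeriv {n : ℕ} {E : Type*} [NormedAddCommGroup E] [NormedSpace ℝ E]
    {f : O n → E} (hf : IsSmooth f) (U : VectorField n) : IsSmooth (dirDeriv U f) := by
  intro g
  obtain ⟨S, hS, hg, F, hF, hFf⟩ := hf g
  obtain ⟨T, hT, hgT, W, hW, hWU⟩ := U.2.1 g
  refine ⟨S ∩ T, hS.inter hT, ⟨hg, hgT⟩, fun A => fderiv ℝ F A (W A), ?_, ?_⟩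
  · exact ((hF.fderiv_of_isOpen hS (by simp)).mono Set.inter_subset_left).clm_apply
      (hW.mono Set.inter_subset_right)
  · intro h hh
    simp only [hWU h hh.2]
    exact (hasDerivAt_of_extension U hS hh.1 hF hFf).deriv.symm

/-- The projection of the space of matrices onto `𝔬(n,1)`. -/
def proj (n : ℕ) : Mat n →ₗ[ℝ] 𝔬 n where
  toFun A := ⟨(1 / 2 : ℝ) • (A - J n * Aᵀ * J n), by
    rw [mem_𝔬, Matrix.transpose_smul, Matrix.transpose_sub, Matrix.transpose_mul,
      Matrix.transpose_mul, J_transpose, Matrix.transpose_transpose]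
    have h : J n * (Aᵀ - J n * (A * J n)) * J n
        = J n * Aᵀ * J n - (J n * J n) * A * (J n * J n) := by noncomm_ring
    rw [mul_smul_comm, smul_mul_assoc, h, J_mul_J, one_mul, mul_one, ← smul_neg, neg_sub]⟩
  map_add' A B := by
    apply Subtype.ext
    change (1 / 2 : ℝ) • ((A + B) - J n * (A + B)ᵀ * J n)
      = (1 / 2 : ℝ) • (A - J n * Aᵀ * J n) + (1 / 2 : ℝ) • (B - J n * Bᵀ * J n)
    rw [Matrix.transpose_add, ← smul_add]
    congr 1
    noncomm_ring
  map_smul' c A := by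
    apply Subtype.ext
    change (1 / 2 : ℝ) • ((c • A) - J n * (c • A)ᵀ * J n)
      = c • ((1 / 2 : ℝ) • (A - J n * Aᵀ * J n))
    rw [Matrix.transpose_smul, mul_smul_comm, smul_mul_assoc, ← smul_sub, smul_comm]

lemma proj_coe {n : ℕ} (X : 𝔬 n) : proj n (X : Mat n) = X := by
  apply Subtype.ext
  change (1 / 2 : ℝ) • ((X : Mat n) - J n * (X : Mat n)ᵀ * J n) = X
  rw [mem_𝔬.1 X.2, sub_neg_eq_add, ← two_smul ℝ, smul_smul]
  norm_num

lemma isSmooth_linear {n : ℕ} {E F : Type*} [NormedAddCommGroup E] [NormedSpace ℝ E]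
    [FiniteDimensional ℝ E] [NormedAddCommGroup F] [NormedSpace ℝ F] {f : O n → E}
    (hf : IsSmooth f) (L : E →ₗ[ℝ] F) : IsSmooth (fun g => L (f g)) :=
  hf.comp (LinearMap.toContinuousLinearMap L).contDiff

lemma hasDerivAt_linear {E F : Type*} [NormedAddCommGroup E] [NormedSpace ℝ E]
    [FiniteDimensional ℝ E] [NormedAddCommGroup F] [NormedSpace ℝ F] (L : E →ₗ[ℝ] F) {f : ℝ → E}
    {f' : E} {t : ℝ} (hf : HasDerivAt f f' t) : HasDerivAt (fun s => L (f s)) (L f') t :=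
  (LinearMap.toContinuousLinearMap L).hasFDerivAt.comp_hasDerivAt t hf

lemma isSmooth_bilinear {n : ℕ} {E F G : Type*} [NormedAddCommGroup E] [NormedSpace ℝ E]
    [FiniteDimensional ℝ E] [NormedAddCommGroup F] [NormedSpace ℝ F] [FiniteDimensional ℝ F]
    [NormedAddCommGroup G] [NormedSpace ℝ G] (L : E →ₗ[ℝ] F →ₗ[ℝ] G) {f : O n → E} {k : O n → F}
    (hf : IsSmooth f) (hk : IsSmooth k) : IsSmooth (fun g => L (f g) (k g)) :=
  hf.map₂ hk (b := fun p : E × F => L.toContinuousBilinearMap p.1 p.2)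
    ((L.toContinuousBilinearMap.contDiff.comp contDiff_fst).clm_apply contDiff_snd)

lemma hasDerivAt_bilinear {E F G : Type*} [NormedAddCommGroup E] [NormedSpace ℝ E]
    [FiniteDimensional ℝ E] [NormedAddCommGroup F] [NormedSpace ℝ F] [FiniteDimensional ℝ F]
    [NormedAddCommGroup G] [NormedSpace ℝ G] (L : E →ₗ[ℝ] F →ₗ[ℝ] G) {f : ℝ → E} {k : ℝ → F}
    {f' : E} {k' : F} {t : ℝ} (hf : HasDerivAt f f' t) (hk : HasDerivAt k k' t) :
    HasDerivAt (fun s => L (f s) (k s)) (L (f t) k' + L f' (k t)) t := by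
  have h := L.toContinuousBilinearMap.hasFDerivAt_of_bilinear hf.hasFDerivAt hk.hasFDerivAt
  have h' := h.hasDerivAt
  simpa using h'

lemma isSmooth_pull {n : ℕ} (V : VectorField n) : IsSmooth V.pull := by
  have hinv : IsSmooth (fun g : O n => toMat g⁻¹) := by
    have h := isSmooth_linear (isSmooth_of_contDiff (n := n) contDiff_id)
      (Matrix.transposeLinearEquiv (Fin n ⊕ Unit) (Fin n ⊕ Unit) ℝ ℝ).toLinearMap
    have h' := h.comp (b := fun A : Mat n => J n * A * J n)
      ((contDiff_const.mul contDiff_id).mul contDiff_const)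
    convert h' using 2 with g
    exact toMat_inv g
  have h := isSmooth_linear (hinv.mul V.2.1) (proj n)
  convert h using 2 with g
  exact (proj_coe (V.pull g)).symm

/-- The smooth vector field with a given left trivialization. -/
def ofPull {n : ℕ} (v : O n → 𝔬 n) (hv : IsSmooth v) : VectorField n :=
  ⟨fun g => toMat g * (v g : Mat n),
    (isSmooth_of_contDiff contDiff_id).mul (isSmooth_linear hv (incl n)),
    fun g => by
      change toMat g⁻¹ * (toMat g * (v g : Mat n)) ∈ 𝔬 n
      rw [← mul_assoc, toMat_inv_mul, one_mul]
      exact (v g).2⟩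

lemma pull_ofPull {n : ℕ} (v : O n → 𝔬 n) (hv : IsSmooth v) (g : O n) :
    (ofPull v hv).pull g = v g := by
  apply Subtype.ext
  change toMat g⁻¹ * (toMat g * (v g : Mat n)) = v g
  rw [← mul_assoc, toMat_inv_mul, one_mul]

lemma VectorField.ext_pull {n : ℕ} {U V : VectorField n} (h : ∀ g, U.pull g = V.pull g) :
    U = V := by
  apply Subtype.ext
  funext g
  rw [← toMat_mul_pull U, ← toMat_mul_pull V, h]

lemma dirDeriv_eq {n : ℕ} (U V : VectorField n) (g : O n) :
    dirDeriv U V.1 g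
      = toMat g * ((U.pull g : Mat n) * (V.pull g : Mat n) + (dirDeriv U V.pull g : 𝔬 n)) := by
  have hc := hasDerivAt_curve g (U.pull g)
  have hv := hasDerivAt_linear (incl n) ((isSmooth_pull V).hasDerivAt U g)
  have h := hc.mul hv
  have heq : (fun t : ℝ => V.1 (g * expO (t • U.pull g))) =
      fun t : ℝ => toMat (g * expO (t • U.pull g)) *
        ((V.pull (g * expO (t • U.pull g)) : 𝔬 n) : Mat n) := by
    funext t
    rw [toMat_mul_pull]
  unfold dirDeriv
  rw [heq]
  refine h.deriv.trans ?_
  simp only [expO_zero_smul]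
  rw [mul_add, ← mul_assoc]
  rfl

/-- The Lie bracket of vector fields, `[U,V] = U(V) - V(U)` with `U(V)` the derivative along `U` of
the matrix-valued function `V`. -/
def bracket {n : ℕ} (U V : VectorField n) : VectorField n :=
  ⟨fun g => dirDeriv U V.1 g - dirDeriv V U.1 g,
    (V.2.1.dirDeriv U).sub (U.2.1.dirDeriv V), fun g => by
      change toMat g⁻¹ * (dirDeriv U V.1 g - dirDeriv V U.1 g) ∈ 𝔬 n
      rw [dirDeriv_eq, dirDeriv_eq, ← mul_sub, ← mul_assoc, toMat_inv_mul, one_mul, add_sub_add_comm]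
      exact add_mem ⁅U.pull g, V.pull g⁆.2
        (sub_mem (dirDeriv U V.pull g).2 (dirDeriv V U.pull g).2)⟩

lemma pull_bracket {n : ℕ} (U V : VectorField n) (g : O n) :
    (bracket U V).pull g
      = ⁅U.pull g, V.pull g⁆ + (dirDeriv U V.pull g - dirDeriv V U.pull g) := by
  apply Subtype.ext
  change toMat g⁻¹ * (dirDeriv U V.1 g - dirDeriv V U.1 g) = _
  rw [dirDeriv_eq, dirDeriv_eq, ← mul_sub, ← mul_assoc, toMat_inv_mul, one_mul, add_sub_add_comm]
  rfl

/-! ### The left-invariant metric, its Levi-Civita connection and its curvature -/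

/-- The left-invariant metric `g̃₀ = g₀ / (2(n-1))` on `O(n,1)`, evaluated on two vector fields. -/
def metric {n : ℕ} (U V : VectorField n) (g : O n) : ℝ := rescaledInner (U.pull g) (V.pull g)

lemma IsSmooth.dirDeriv_smul {n : ℕ} {E : Type*} [NormedAddCommGroup E] [NormedSpace ℝ E]
    {f : O n → ℝ} {k : O n → E} (hf : IsSmooth f) (hk : IsSmooth k) (U : VectorField n) (g : O n) :
    Lorentz.dirDeriv U (fun h => f h • k h) g
      = f g • Lorentz.dirDeriv U k g + Lorentz.dirDeriv U f g • k g := by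
  have h := ((hf.hasDerivAt U g).smul (hk.hasDerivAt U g)).deriv
  simp only [expO_zero_smul] at h
  exact h

/-- An affine connection on the tangent bundle of `O(n,1)`: `nabla U V` is `∇_U V`. -/
structure AffineConnection (n : ℕ) where
  nabla : VectorField n → VectorField n → VectorField n
  add_left : ∀ U U' V, nabla (U + U') V = nabla U V + nabla U' V
  smul_left : ∀ (f : SmoothFunction n) U V, nabla (U.fsmul f) V = (nabla U V).fsmul f
  add_right : ∀ U V V', nabla U (V + V') = nabla U V + nabla U V'
  leibniz : ∀ (f : SmoothFunction n) U V,
    nabla U (V.fsmul f) = (nabla U V).fsmul f + V.fsmul ⟨dirDeriv U f.1, f.2.dirDeriv U⟩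

/-- The connection is torsion free and compatible with the metric `g̃₀`. -/
structure AffineConnection.IsLeviCivita {n : ℕ} (C : AffineConnection n) : Prop where
  torsion_free : ∀ U V, C.nabla U V - C.nabla V U = bracket U V
  metric_compatible : ∀ U V W g,
    dirDeriv U (metric V W) g = metric (C.nabla U V) W g + metric V (C.nabla U W) g

/-- The curvature tensor `R(U,V)W = ∇_U ∇_V W - ∇_V ∇_U W - ∇_{[U,V]} W`. -/
def AffineConnection.curvature {n : ℕ} (C : AffineConnection n) (U V W : VectorField n) :
    VectorField n :=
  C.nabla U (C.nabla V W) - C.nabla V (C.nabla U W) - C.nabla (bracket U V) W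

/-- The sectional curvature at `g` of the plane spanned by the values at `g` of `U` and `V`:
`⟨R(U,V)V,U⟩ / (‖U‖² ‖V‖² - ⟨U,V⟩²)`. -/
def AffineConnection.sectionalCurvature {n : ℕ} (C : AffineConnection n) (U V : VectorField n)
    (g : O n) : ℝ :=
  metric (C.curvature U V V) U g /
    (metric U U g * metric V V g - metric U V g ^ 2)

/-! ### Existence of the Levi-Civita connection -/

/-- `θ` as an automorphism of the Lie algebra `𝔬(n,1)`. -/
def θEquiv (n : ℕ) : 𝔬 n ≃ₗ⁅ℝ⁆ 𝔬 n where
  toFun := θ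
  map_add' X Y := by
    apply Subtype.ext
    change -((X : Mat n) + (Y : Mat n))ᵀ = -(X : Mat n)ᵀ + -(Y : Mat n)ᵀ
    rw [Matrix.transpose_add, neg_add]
  map_smul' c X := by
    apply Subtype.ext
    change -(c • (X : Mat n))ᵀ = c • -(X : Mat n)ᵀ
    rw [Matrix.transpose_smul, smul_neg]
  map_lie' := by
    intro X Y
    apply Subtype.ext
    change -((X : Mat n) * (Y : Mat n) - (Y : Mat n) * (X : Mat n))ᵀ
      = (-(X : Mat n)ᵀ) * (-(Y : Mat n)ᵀ) - (-(Y : Mat n)ᵀ) * (-(X : Mat n)ᵀ)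
    rw [Matrix.transpose_sub, Matrix.transpose_mul, Matrix.transpose_mul]
    noncomm_ring
  invFun := θ
  left_inv X := by
    apply Subtype.ext
    change -(-(X : Mat n)ᵀ)ᵀ = X
    rw [Matrix.transpose_neg, neg_neg, Matrix.transpose_transpose]
  right_inv X := by
    apply Subtype.ext
    change -(-(X : Mat n)ᵀ)ᵀ = X
    rw [Matrix.transpose_neg, neg_neg, Matrix.transpose_transpose]

lemma θEquiv_apply {n : ℕ} (X : 𝔬 n) : θEquiv n X = θ X := rfl

lemma θ_lie {n : ℕ} (X Y : 𝔬 n) : θ ⁅X, Y⁆ = ⁅θ X, θ Y⁆ := (θEquiv n).map_lie X Y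

lemma θ_θ {n : ℕ} (X : 𝔬 n) : θ (θ X) = X := (θEquiv n).left_inv X

/-- The rescaled inner product as a bilinear map. -/
def rescaledForm (n : ℕ) : 𝔬 n →ₗ[ℝ] 𝔬 n →ₗ[ℝ] ℝ :=
  LinearMap.mk₂ ℝ rescaledInner
    (by
      intro X X' Y
      simp only [rescaledInner, canonicalInner, map_add, LinearMap.add_apply]
      ring)
    (by
      intro c X Y
      simp only [rescaledInner, canonicalInner, map_smul, LinearMap.smul_apply, smul_eq_mul]
      ring)
    (by
      intro X Y Y'
      simp only [rescaledInner, canonicalInner, ← θEquiv_apply, map_add]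
      ring)
    (by
      intro c X Y
      simp only [rescaledInner, canonicalInner, ← θEquiv_apply, map_smul, smul_eq_mul]
      ring)

lemma rescaledForm_apply {n : ℕ} (X Y : 𝔬 n) : rescaledForm n X Y = rescaledInner X Y := rfl

lemma rescaledInner_lie {n : ℕ} (X Y Z : 𝔬 n) :
    rescaledInner ⁅X, Y⁆ Z = -rescaledInner Y ⁅θ X, Z⁆ := by
  have h : killingForm ℝ (𝔬 n) ⁅X, Y⁆ (θ Z) = -killingForm ℝ (𝔬 n) Y ⁅X, θ Z⁆ :=
    LieModule.traceForm_apply_lie_apply' ℝ (𝔬 n) (𝔬 n) X Y (θ Z)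
  simp only [rescaledInner, canonicalInner, θ_lie, θ_θ, h]
  ring

lemma rescaledInner_comm {n : ℕ} (X Y : 𝔬 n) : rescaledInner X Y = rescaledInner Y X := by
  have h := LieAlgebra.killingForm_of_equiv_apply (R := ℝ) (θEquiv n) X (θ Y)
  rw [θEquiv_apply, θEquiv_apply, θ_θ] at h
  have h' : killingForm ℝ (𝔬 n) (θ X) Y = killingForm ℝ (𝔬 n) Y (θ X) :=
    LieModule.traceForm_comm ℝ (𝔬 n) (𝔬 n) (θ X) Y
  simp only [rescaledInner, canonicalInner, ← h, h']

/-- The value `∇_X Y = ([X,Y] + [θX,Y] + [θY,X]) / 2` of the Levi-Civita connection on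
left-invariant fields. -/
def christoffel (n : ℕ) : 𝔬 n →ₗ[ℝ] 𝔬 n →ₗ[ℝ] 𝔬 n :=
  LinearMap.mk₂ ℝ (fun X Y => (1 / 2 : ℝ) • (⁅X, Y⁆ + ⁅θ X, Y⁆ + ⁅θ Y, X⁆))
    (by
      intro X X' Y
      simp only [← θEquiv_apply, map_add, add_lie, lie_add, ← smul_add]
      congr 1
      abel)
    (by
      intro c X Y
      simp only [← θEquiv_apply, map_smul, smul_lie, lie_smul, ← smul_add]
      rw [smul_comm])
    (by
      intro X Y Y'
      simp only [← θEquiv_apply, map_add, add_lie, lie_add, ← smul_add]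
      congr 1
      abel)
    (by
      intro c X Y
      simp only [← θEquiv_apply, map_smul, smul_lie, lie_smul, ← smul_add]
      rw [smul_comm])

lemma christoffel_apply {n : ℕ} (X Y : 𝔬 n) :
    christoffel n X Y = (1 / 2 : ℝ) • (⁅X, Y⁆ + ⁅θ X, Y⁆ + ⁅θ Y, X⁆) := rfl

lemma christoffel_sub {n : ℕ} (X Y : 𝔬 n) :
    christoffel n X Y - christoffel n Y X = ⁅X, Y⁆ := by
  rw [christoffel_apply, christoffel_apply, ← smul_sub, ← lie_skew X Y]
  have h : ⁅X, Y⁆ = -⁅Y, X⁆ := (lie_skew X Y).symm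
  rw [show -⁅Y, X⁆ + ⁅θ X, Y⁆ + ⁅θ Y, X⁆ - (⁅Y, X⁆ + ⁅θ Y, X⁆ + ⁅θ X, Y⁆) = (2 : ℝ) • -⁅Y, X⁆ by
    rw [two_smul]; abel, smul_smul]
  norm_num

lemma christoffel_skew {n : ℕ} (X Y Z : 𝔬 n) :
    rescaledInner (christoffel n X Y) Z + rescaledInner Y (christoffel n X Z) = 0 := by
  have e1 : rescaledInner (christoffel n X Y) Z = (1 / 2 : ℝ) *
      (rescaledInner ⁅X, Y⁆ Z + rescaledInner ⁅θ X, Y⁆ Z + rescaledInner ⁅θ Y, X⁆ Z) := by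
    rw [christoffel_apply]
    simp only [← rescaledForm_apply, map_add, map_smul, LinearMap.add_apply, LinearMap.smul_apply,
      smul_eq_mul]
  have e2 : rescaledInner Y (christoffel n X Z) = (1 / 2 : ℝ) *
      (rescaledInner Y ⁅X, Z⁆ + rescaledInner Y ⁅θ X, Z⁆ + rescaledInner Y ⁅θ Z, X⁆) := by
    rw [christoffel_apply]
    simp only [← rescaledForm_apply, map_add, map_smul, smul_eq_mul]
  have h1 := rescaledInner_lie X Y Z
  have h2 := rescaledInner_lie (θ X) Y Z
  have h3 := rescaledInner_lie (θ Y) X Z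
  have h4 := rescaledInner_lie (θ Z) X Y
  rw [θ_θ] at h2 h3 h4
  have h5 : rescaledInner X ⁅Y, Z⁆ = -rescaledInner X ⁅Z, Y⁆ := by
    rw [← lie_skew Y Z, ← rescaledForm_apply, map_neg, rescaledForm_apply]
  have h6 := rescaledInner_comm Y ⁅θ Z, X⁆
  rw [e1, e2]
  linarith

lemma pull_add {n : ℕ} (U V : VectorField n) (g : O n) :
    (U + V).pull g = U.pull g + V.pull g := by
  apply Subtype.ext
  exact mul_add (toMat g⁻¹) (U.1 g) (V.1 g)

lemma pull_sub {n : ℕ} (U V : VectorField n) (g : O n) :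
    (U - V).pull g = U.pull g - V.pull g := by
  apply Subtype.ext
  exact mul_sub (toMat g⁻¹) (U.1 g) (V.1 g)

lemma pull_fsmul {n : ℕ} (f : SmoothFunction n) (V : VectorField n) (g : O n) :
    (VectorField.fsmul f V).pull g = f.1 g • V.pull g := by
  apply Subtype.ext
  exact mul_smul_comm (f.1 g) (toMat g⁻¹) (V.1 g)

lemma dirDeriv_add_left {n : ℕ} {E : Type*} [NormedAddCommGroup E] [NormedSpace ℝ E] {f : O n → E}
    (hf : IsSmooth f) (U U' : VectorField n) (g : O n) :
    dirDeriv (U + U') f g = dirDeriv U f g + dirDeriv U' f g := by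
  obtain ⟨S, hS, hg, F, hF, hFf⟩ := hf g
  unfold dirDeriv
  rw [(hasDerivAt_of_extension (U + U') hS hg hF hFf).deriv,
    (hasDerivAt_of_extension U hS hg hF hFf).deriv,
    (hasDerivAt_of_extension U' hS hg hF hFf).deriv]
  exact map_add (fderiv ℝ F (toMat g)) (U.1 g) (U'.1 g)

lemma dirDeriv_fsmul_left {n : ℕ} {E : Type*} [NormedAddCommGroup E] [NormedSpace ℝ E]
    {f : O n → E} (hf : IsSmooth f) (a : SmoothFunction n) (U : VectorField n) (g : O n) :
    dirDeriv (VectorField.fsmul a U) f g = a.1 g • dirDeriv U f g := by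
  obtain ⟨S, hS, hg, F, hF, hFf⟩ := hf g
  unfold dirDeriv
  rw [(hasDerivAt_of_extension (VectorField.fsmul a U) hS hg hF hFf).deriv,
    (hasDerivAt_of_extension U hS hg hF hFf).deriv]
  exact map_smul (fderiv ℝ F (toMat g)) (a.1 g) (U.1 g)

lemma dirDeriv_add_right {n : ℕ} {E : Type*} [NormedAddCommGroup E] [NormedSpace ℝ E]
    {f k : O n → E} (hf : IsSmooth f) (hk : IsSmooth k) (U : VectorField n) (g : O n) :
    dirDeriv U (fun h => f h + k h) g = dirDeriv U f g + dirDeriv U k g :=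
  ((hf.hasDerivAt U g).add (hk.hasDerivAt U g)).deriv

/-- The Levi-Civita connection of `g̃₀`. -/
def leviCivita (n : ℕ) : AffineConnection n where
  nabla U V := ofPull (fun g => dirDeriv U V.pull g + christoffel n (U.pull g) (V.pull g))
    (((isSmooth_pull V).dirDeriv U).add
      (isSmooth_bilinear (christoffel n) (isSmooth_pull U) (isSmooth_pull V)))
  add_left U U' V := by
    apply VectorField.ext_pull
    intro g
    rw [pull_add, pull_ofPull, pull_ofPull, pull_ofPull, dirDeriv_add_left (isSmooth_pull V),
      pull_add, map_add, LinearMap.add_apply]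
    abel
  smul_left f U V := by
    apply VectorField.ext_pull
    intro g
    rw [pull_fsmul, pull_ofPull, pull_ofPull, dirDeriv_fsmul_left (isSmooth_pull V),
      pull_fsmul, map_smul, LinearMap.smul_apply, smul_add]
  add_right U V V' := by
    apply VectorField.ext_pull
    intro g
    have h : (V + V').pull = fun h => V.pull h + V'.pull h := funext (pull_add V V')
    rw [pull_add, pull_ofPull, pull_ofPull, pull_ofPull, h,
      dirDeriv_add_right (isSmooth_pull V) (isSmooth_pull V'), map_add]
    abel
  leibniz f U V := by
    apply VectorField.ext_pull
    intro g
    have h : (VectorField.fsmul f V).pull = fun h => f.1 h • V.pull h := funext (pull_fsmul f V)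
    rw [pull_add, pull_fsmul, pull_fsmul, pull_ofPull, pull_ofPull, h,
      f.2.dirDeriv_smul (isSmooth_pull V), map_smul, smul_add]
    abel

/-- The metric `g̃₀` has a Levi-Civita connection. -/
theorem leviCivita_isLeviCivita (n : ℕ) : (leviCivita n).IsLeviCivita where
  torsion_free U V := by
    apply VectorField.ext_pull
    intro g
    rw [pull_sub, pull_bracket, ← christoffel_sub]
    unfold leviCivita
    rw [pull_ofPull, pull_ofPull]
    abel
  metric_compatible U V W g := by
    have h := (hasDerivAt_bilinear (rescaledForm n) ((isSmooth_pull V).hasDerivAt U g)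
      ((isSmooth_pull W).hasDerivAt U g)).deriv
    simp only [expO_zero_smul] at h
    have hs := christoffel_skew (U.pull g) (V.pull g) (W.pull g)
    unfold leviCivita metric
    rw [pull_ofPull, pull_ofPull]
    refine h.trans ?_
    simp only [← rescaledForm_apply, map_add, LinearMap.add_apply] at hs ⊢
    linarith

end Lorentz

end

namespace Lorentz

/-! ### The Killing form of `𝔬(n,1)` -/

/-! The Killing form of `𝔬 n` is $(n-1)\operatorname{tr}(XY)$, so the factor $1/(2(n-1))$ turns the
metric into half the Frobenius product, independently of $n$ (`killingForm_eq`, `rescaledInner_eq`).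
Commutators then satisfy $|[X,Y]|^2\le 8|X|^2|Y|^2$ (`rescaledInner_lie_self_le`).

Torsion-freeness and metric compatibility force any Levi-Civita connection to be `christoffel` on
left-invariant fields (`nabla_leftInvariant`), so the curvature is algebra on `𝔬 n`. Decompose
$X=A+P$, $Y=B+Q$ into the $+1$ and $-1$ eigenspaces of θ, which are orthogonal. The numerator
$\langle R(X,Y)Y,X\rangle$ becomes a combination of six inner products of brackets of the components
(`curvatureNumerator_cartan`). Dropping the nonpositive term $-\frac74|[P,Q]|^2$ and estimating the
others by Cauchy–Schwarz and the commutator bound gives at most $11|X|^2|Y|^2$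
(`curvatureNumerator_le`).

Replacing $Y$ by its component orthogonal to $X$ leaves the numerator unchanged and makes the
denominator $|X|^2|Y|^2$. Hence $K\le 11$ for every $n\ge2$, and $11\le (n^2+43n)/8$ already at
$n=2$, where the right side is $45/4$. -/

lemma trace_matrix_endomorphism {ι : Type*} [Fintype ι] [DecidableEq ι]
    (L : Matrix ι ι ℝ →ₗ[ℝ] Matrix ι ι ℝ) :
    LinearMap.trace ℝ _ L = ∑ i, ∑ j, L (Matrix.single i j 1) i j := by
  rw [LinearMap.trace_eq_matrix_trace ℝ (Matrix.stdBasis ℝ ι ι), Matrix.trace,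
    Fintype.sum_prod_type]
  refine Finset.sum_congr rfl fun i _ => Finset.sum_congr rfl fun j _ => ?_
  rw [Matrix.diag_apply, LinearMap.toMatrix_apply, Matrix.stdBasis_eq_single]
  rfl

/-- The $(i,j)$ entry of $PE_{ij}Q$ is $P_{ii}Q_{jj}$. -/
lemma trace_mulLeft_mulRight {ι : Type*} [Fintype ι] [DecidableEq ι] (P Q : Matrix ι ι ℝ)
    (L : Matrix ι ι ℝ →ₗ[ℝ] Matrix ι ι ℝ) (hL : ∀ M, L M = P * M * Q) :
    LinearMap.trace ℝ _ L = P.trace * Q.trace := by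
  rw [trace_matrix_endomorphism, Matrix.trace, Matrix.trace, Finset.sum_mul_sum]
  refine Finset.sum_congr rfl fun i _ => Finset.sum_congr rfl fun j _ => ?_
  rw [hL, Matrix.mul_assoc, Matrix.mul_apply]
  simp [Matrix.mul_apply, Matrix.single_apply, ite_and]

/-- The transpose turns $E_{ij}$ into $E_{ji}$, and the $(i,j)$ entry of $PE_{ji}Q$ is
$P_{ij}Q_{ij}$. -/
lemma trace_mul_transpose_mul {ι : Type*} [Fintype ι] [DecidableEq ι] (P Q : Matrix ι ι ℝ)
    (L : Matrix ι ι ℝ →ₗ[ℝ] Matrix ι ι ℝ) (hL : ∀ M, L M = P * Mᵀ * Q) :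
    LinearMap.trace ℝ _ L = (P * Qᵀ).trace := by
  rw [trace_matrix_endomorphism, Matrix.trace]
  refine Finset.sum_congr rfl fun i _ => ?_
  rw [Matrix.diag_apply, Matrix.mul_apply]
  refine Finset.sum_congr rfl fun j _ => ?_
  rw [hL, Matrix.transpose_single, Matrix.mul_assoc, Matrix.mul_apply]
  simp [Matrix.mul_apply, Matrix.single_apply, ite_and]

lemma trace_eq_zero {n : ℕ} (X : 𝔬 n) : (X : Mat n).trace = 0 := by
  have h := congrArg Matrix.trace (mem_𝔬.1 X.2)
  rw [Matrix.trace_mul_comm, ← Matrix.mul_assoc, J_mul_J, Matrix.one_mul, Matrix.trace_transpose,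
    Matrix.trace_neg] at h
  linarith

/-- The map `M ↦ P M Q` on matrices. -/
noncomputable def sandwich {n : ℕ} (P Q : Mat n) : Mat n →ₗ[ℝ] Mat n :=
  LinearMap.mulRight ℝ Q ∘ₗ LinearMap.mulLeft ℝ P

lemma sandwich_apply {n : ℕ} (P Q M : Mat n) : sandwich P Q M = P * M * Q := rfl

/-- The trace over the subspace `𝔬 n` is computed on all matrices: `ad X ∘ ad Y` extends to
$M\mapsto[x,[y,M]]$, and the projection $M\mapsto\frac12(M-JM^TJ)$ cuts it back down. -/
lemma killingForm_eq {n : ℕ} (X Y : 𝔬 n) :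
    killingForm ℝ (𝔬 n) X Y = ((n : ℝ) - 1) * ((X : Mat n) * (Y : Mat n)).trace := by
  set x : Mat n := X.1
  set y : Mat n := Y.1
  set T : Mat n →ₗ[ℝ] Mat n := (Matrix.transposeLinearEquiv _ _ ℝ ℝ).toLinearMap
  -- `D` is $M\mapsto[x,[y,M]]$ expanded into four two-sided multiplications.
  set D : Mat n →ₗ[ℝ] Mat n :=
    sandwich (x * y) 1 - sandwich x y - sandwich y x + sandwich 1 (y * x)
  have hD : ∀ M, D M = x * y * M * 1 - x * M * y - y * M * x + 1 * M * (y * x) := fun _ => rfl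
  have h1 : LieAlgebra.ad ℝ (𝔬 n) X ∘ₗ LieAlgebra.ad ℝ (𝔬 n) Y = proj n ∘ₗ (D ∘ₗ incl n) := by
    ext1 Z
    have h : D (incl n Z) = (⁅X, ⁅Y, Z⁆⁆ : 𝔬 n) := by
      rw [hD]
      change _ = x * (y * (Z : Mat n) - (Z : Mat n) * y) - (y * (Z : Mat n) - (Z : Mat n) * y) * x
      change x * y * (Z : Mat n) * 1 - x * (Z : Mat n) * y - y * (Z : Mat n) * x
        + 1 * (Z : Mat n) * (y * x) = _
      noncomm_ring
    change _ = proj n (D (incl n Z))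
    rw [h, proj_coe]
    rfl
  have h2 : (D ∘ₗ incl n) ∘ₗ proj n
      = (1 / 2 : ℝ) • (D - (sandwich (x * y * J n) (J n) ∘ₗ T - sandwich (x * J n) (J n * y) ∘ₗ T
        - sandwich (y * J n) (J n * x) ∘ₗ T + sandwich (J n) (J n * (y * x)) ∘ₗ T)) := by
    ext1 M
    change D ((1 / 2 : ℝ) • (M - J n * Mᵀ * J n)) = (1 / 2 : ℝ) •
      (D M - (x * y * J n * Mᵀ * J n - x * J n * Mᵀ * (J n * y) - y * J n * Mᵀ * (J n * x)
        + J n * Mᵀ * (J n * (y * x))))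
    rw [map_smul, map_sub]
    congr 2
    rw [hD]
    noncomm_ring
  have hx : J n * xᵀ * J n = -x := mem_𝔬.1 X.2
  have hy : J n * yᵀ * J n = -y := mem_𝔬.1 Y.2
  have hyx : J n * (y * x)ᵀ * J n = x * y := by
    calc J n * (y * x)ᵀ * J n = (J n * xᵀ) * 1 * (yᵀ * J n) := by
          rw [Matrix.transpose_mul]; noncomm_ring
      _ = (J n * xᵀ * J n) * (J n * yᵀ * J n) := by rw [← J_mul_J]; noncomm_ring
      _ = x * y := by rw [hx, hy]; noncomm_ring
  have tx : x.trace = 0 := trace_eq_zero X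
  have ty : y.trace = 0 := trace_eq_zero Y
  have txy : (y * x).trace = (x * y).trace := Matrix.trace_mul_comm _ _
  have s1 (P Q : Mat n) : LinearMap.trace ℝ _ (sandwich P Q) = P.trace * Q.trace :=
    trace_mulLeft_mulRight P Q _ fun _ => rfl
  have s2 (P Q : Mat n) : LinearMap.trace ℝ _ (sandwich P Q ∘ₗ T) = (P * Qᵀ).trace :=
    trace_mul_transpose_mul P Q _ fun _ => rfl
  have t1 : (x * y * J n * (J n)ᵀ).trace = (x * y).trace := by
    rw [J_transpose, Matrix.mul_assoc, J_mul_J, Matrix.mul_one]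
  have t2 : (x * J n * (J n * y)ᵀ).trace = -(x * y).trace := by
    rw [Matrix.transpose_mul, J_transpose, Matrix.mul_assoc, ← Matrix.mul_assoc (J n), hy,
      Matrix.mul_neg, Matrix.trace_neg]
  have t3 : (y * J n * (J n * x)ᵀ).trace = -(x * y).trace := by
    rw [Matrix.transpose_mul, J_transpose, Matrix.mul_assoc, ← Matrix.mul_assoc (J n), hx,
      Matrix.mul_neg, Matrix.trace_neg, txy]
  have t4 : (J n * (J n * (y * x))ᵀ).trace = (x * y).trace := by
    rw [Matrix.transpose_mul, J_transpose, ← Matrix.mul_assoc, hyx]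
  have tD : LinearMap.trace ℝ _ D = 2 * ((n : ℝ) + 1) * (x * y).trace := by
    simp only [D, map_add, map_sub, s1, tx, ty, txy, Matrix.trace_one]
    simp
    ring
  clear_value D
  have hk : killingForm ℝ (𝔬 n) X Y = LinearMap.trace ℝ _ (proj n ∘ₗ (D ∘ₗ incl n)) := by
    rw [← h1]
    rfl
  -- Cyclicity of the trace moves `proj n` to the right of `incl n`. The plain part contributes
  -- $2(n+1)\operatorname{tr}(xy)$, the transposed part $4\operatorname{tr}(xy)$, and half their
  -- difference is $(n-1)\operatorname{tr}(xy)$.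
  rw [hk, LinearMap.trace_comp_comm', h2, map_smul, map_sub, map_add, map_sub, map_sub, tD, s2, s2,
    s2, s2, t1, t2, t3, t4, smul_eq_mul]
  ring

/-! ### The inner product as half the Frobenius product, and commutator estimates. -/

lemma rescaledInner_eq {n : ℕ} (hn : 2 ≤ n) (X Y : 𝔬 n) :
    rescaledInner X Y = 1 / 2 * ∑ i, ∑ j, (X : Mat n) i j * (Y : Mat n) i j := by
  have hn' : (2 : ℝ) ≤ n := by exact_mod_cast hn
  have h : (n : ℝ) - 1 ≠ 0 := by linarith
  have e : ((X : Mat n) * (θ Y : Mat n)).trace = -∑ i, ∑ j, (X : Mat n) i j * (Y : Mat n) i j := by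
    change ((X : Mat n) * (-(Y : Mat n)ᵀ)).trace = _
    rw [Matrix.mul_neg, Matrix.trace_neg]
    rfl
  rw [rescaledInner, canonicalInner, killingForm_eq, e]
  field_simp

lemma rescaledInner_sq_le {n : ℕ} (hn : 2 ≤ n) (X Y : 𝔬 n) :
    rescaledInner X Y ^ 2 ≤ rescaledInner X X * rescaledInner Y Y := by
  simp only [rescaledInner_eq hn, ← Fintype.sum_prod_type']
  have h := Finset.sum_mul_sq_le_sq_mul_sq Finset.univ
    (fun p : (Fin n ⊕ Unit) × (Fin n ⊕ Unit) => (X : Mat n) p.1 p.2) (fun p => (Y : Mat n) p.1 p.2)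
  simp only [sq] at h ⊢
  linarith

lemma rescaledInner_self_nonneg {n : ℕ} (hn : 2 ≤ n) (X : 𝔬 n) : 0 ≤ rescaledInner X X := by
  rw [rescaledInner_eq hn]
  exact mul_nonneg (by norm_num)
    (Finset.sum_nonneg fun i _ => Finset.sum_nonneg fun j _ => mul_self_nonneg _)

lemma eq_zero_of_rescaledInner_self {n : ℕ} (hn : 2 ≤ n) {X : 𝔬 n} (h : rescaledInner X X = 0) :
    X = 0 := by
  rw [rescaledInner_eq hn] at h
  have h' : ∑ i, ∑ j, (X : Mat n) i j * (X : Mat n) i j = 0 := by linarith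
  apply Subtype.ext
  ext i j
  have hi := (Finset.sum_eq_zero_iff_of_nonneg
    fun i _ => Finset.sum_nonneg fun j _ => mul_self_nonneg _).1 h' i (Finset.mem_univ i)
  exact mul_self_eq_zero.1
    ((Finset.sum_eq_zero_iff_of_nonneg fun j _ => mul_self_nonneg _).1 hi j (Finset.mem_univ j))

/-- Submultiplicativity of the Frobenius norm: Cauchy–Schwarz for each row of `A` against each
column of `B`. -/
lemma sum_sq_mul_le {ι : Type*} [Fintype ι] (A B : Matrix ι ι ℝ) :
    ∑ i, ∑ j, (A * B) i j ^ 2 ≤ (∑ i, ∑ j, A i j ^ 2) * ∑ i, ∑ j, B i j ^ 2 := by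
  rw [Finset.sum_mul]
  refine Finset.sum_le_sum fun i _ => ?_
  rw [Finset.sum_comm (f := fun i j => B i j ^ 2), Finset.mul_sum]
  refine Finset.sum_le_sum fun j _ => ?_
  rw [Matrix.mul_apply]
  exact Finset.sum_mul_sq_le_sq_mul_sq _ _ _

/-- In Frobenius norms, $(s-t)^2\le 2s^2+2t^2$ and submultiplicativity give the constant $4$. It
doubles because the inner product carries a factor $\frac12$, once on the left and twice on the
right. -/
lemma rescaledInner_lie_self_le {n : ℕ} (hn : 2 ≤ n) (X Y : 𝔬 n) :
    rescaledInner ⁅X, Y⁆ ⁅X, Y⁆ ≤ 8 * (rescaledInner X X * rescaledInner Y Y) := by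
  simp only [rescaledInner_eq hn, ← sq]
  set x : Mat n := X.1
  set y : Mat n := Y.1
  have h : ∑ i, ∑ j, ((⁅X, Y⁆ : 𝔬 n) : Mat n) i j ^ 2
      ≤ ∑ i, ∑ j, (2 * (x * y) i j ^ 2 + 2 * (y * x) i j ^ 2) := by
    refine Finset.sum_le_sum fun i _ => Finset.sum_le_sum fun j _ => ?_
    change ((x * y) i j - (y * x) i j) ^ 2 ≤ _
    linarith [sq_nonneg ((x * y) i j + (y * x) i j)]
  simp only [Finset.sum_add_distrib, ← Finset.mul_sum] at h
  linarith [sum_sq_mul_le x y, sum_sq_mul_le y x]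

/-! ### The Levi-Civita connection on left-invariant fields -/

lemma dirDeriv_const {n : ℕ} {E : Type*} [NormedAddCommGroup E] [NormedSpace ℝ E]
    (U : VectorField n) (c : E) (g : O n) : dirDeriv U (fun _ => c) g = 0 :=
  deriv_const _ _

lemma pull_leftInvariant_fun {n : ℕ} (X : 𝔬 n) : (leftInvariant X).pull = fun _ => X :=
  funext (pull_leftInvariant X)

lemma bracket_leftInvariant {n : ℕ} (X Y : 𝔬 n) :
    bracket (leftInvariant X) (leftInvariant Y) = leftInvariant ⁅X, Y⁆ := by
  apply VectorField.ext_pull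
  intro g
  rw [pull_bracket, pull_leftInvariant_fun, pull_leftInvariant_fun, pull_leftInvariant_fun,
    dirDeriv_const, dirDeriv_const, sub_zero, add_zero]

/-- A bilinear product on `𝔬(n,1)` that is torsion free and skew for the inner product is the one of
the Levi-Civita connection. -/
lemma eq_christoffel {n : ℕ} (hn : 2 ≤ n) {G : 𝔬 n → 𝔬 n → 𝔬 n}
    (ht : ∀ X Y, G X Y - G Y X = ⁅X, Y⁆)
    (hs : ∀ X Y Z, rescaledInner (G X Y) Z + rescaledInner Y (G X Z) = 0) (X Y : 𝔬 n) :
    G X Y = christoffel n X Y := by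
  have hsymm (X Y : 𝔬 n) : G X Y - christoffel n X Y = G Y X - christoffel n Y X := by
    have h := (ht X Y).trans (christoffel_sub X Y).symm
    rw [sub_eq_sub_iff_add_eq_add] at h ⊢
    rw [add_comm (G Y X), h, add_comm]
  have hskew (X Y Z : 𝔬 n) : rescaledForm n (G X Y - christoffel n X Y) Z
      = -rescaledForm n (G X Z - christoffel n X Z) Y := by
    have h1 := hs X Y Z
    have h2 := christoffel_skew X Y Z
    rw [rescaledInner_comm Y] at h1 h2
    simp only [← rescaledForm_apply, map_sub, LinearMap.sub_apply] at h1 h2 ⊢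
    linarith
  -- The trilinear difference form is symmetric in its first two slots and skew in its last two.
  -- Going around the three slots alternately by these symmetries returns it to itself with the
  -- opposite sign.
  have hzero (Z : 𝔬 n) : rescaledForm n (G X Y - christoffel n X Y) Z = 0 := by
    have h1 := hskew X Y Z
    have h2 := hskew Z X Y
    have h3 := hskew Y Z X
    rw [hsymm X Z] at h1
    rw [hsymm Z Y] at h2
    rw [hsymm Y X] at h3
    linarith
  exact sub_eq_zero.1 (eq_zero_of_rescaledInner_self hn (hzero _))

/-- At a fixed `g`, the connection induces a product on `𝔬 n`. Inner products of left-invariant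
fields are constant, so compatibility says that this product is skew, and `eq_christoffel` applies.
-/
lemma nabla_leftInvariant {n : ℕ} (hn : 2 ≤ n) {C : AffineConnection n} (hC : C.IsLeviCivita)
    (X Y : 𝔬 n) :
    C.nabla (leftInvariant X) (leftInvariant Y) = leftInvariant (christoffel n X Y) := by
  apply VectorField.ext_pull
  intro g
  rw [pull_leftInvariant]
  refine eq_christoffel hn
    (G := fun X Y => (C.nabla (leftInvariant X) (leftInvariant Y)).pull g) ?_ ?_ X Y
  · intro X Y
    rw [← pull_sub, hC.torsion_free, bracket_leftInvariant, pull_leftInvariant]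
  · intro X Y Z
    have h := hC.metric_compatible (leftInvariant X) (leftInvariant Y) (leftInvariant Z) g
    have hc : metric (leftInvariant Y) (leftInvariant Z) = fun _ => rescaledInner Y Z := by
      funext g
      rw [metric, pull_leftInvariant, pull_leftInvariant]
    rw [hc, dirDeriv_const, metric, metric, pull_leftInvariant, pull_leftInvariant] at h
    exact h.symm

/-- The value of `⟨R(X,Y)Y,X⟩` on left-invariant vector fields. -/
noncomputable def curvatureNumerator {n : ℕ} (X Y : 𝔬 n) : ℝ :=
  rescaledForm n (christoffel n X (christoffel n Y Y) - christoffel n Y (christoffel n X Y)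
    - christoffel n ⁅X, Y⁆ Y) X

lemma sectionalCurvature_leftInvariant {n : ℕ} (hn : 2 ≤ n) {C : AffineConnection n}
    (hC : C.IsLeviCivita) (X Y : 𝔬 n) (g : O n) :
    C.sectionalCurvature (leftInvariant X) (leftInvariant Y) g = curvatureNumerator X Y /
      (rescaledInner X X * rescaledInner Y Y - rescaledInner X Y ^ 2) := by
  simp only [AffineConnection.sectionalCurvature, AffineConnection.curvature,
    bracket_leftInvariant, nabla_leftInvariant hn hC, metric, pull_sub, pull_leftInvariant]
  rfl

/-! ### The curvature in terms of the Cartan decomposition -/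

lemma rescaledForm_christoffel_skew {n : ℕ} (X Y Z : 𝔬 n) :
    rescaledForm n (christoffel n X Y) Z = -rescaledForm n Y (christoffel n X Z) :=
  eq_neg_of_add_eq_zero_left (christoffel_skew X Y Z)

/-- Skewness of `christoffel` moves each outer derivative to the other side of the inner product, so
no iterated product remains except the bracket term. -/
lemma curvatureNumerator_eq {n : ℕ} (X Y : 𝔬 n) :
    curvatureNumerator X Y = -rescaledForm n (christoffel n Y Y) (christoffel n X X)
      + rescaledForm n (christoffel n X Y) (christoffel n Y X)
      - rescaledForm n (christoffel n ⁅X, Y⁆ Y) X := by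
  rw [curvatureNumerator, map_sub, map_sub, LinearMap.sub_apply, LinearMap.sub_apply,
    rescaledForm_christoffel_skew X, rescaledForm_christoffel_skew Y (christoffel n X Y)]
  ring

/-- The quantity `⟨R(X,Y)Y,X⟩` does not change when a multiple of `X` is subtracted from `Y`. -/
lemma curvatureNumerator_sub_smul {n : ℕ} (X Y : 𝔬 n) (c : ℝ) :
    curvatureNumerator X (Y - c • X) = curvatureNumerator X Y := by
  -- The change in the numerator is a multiple of $\langle R(X,Y)X,X\rangle$. Its bracket term
  -- vanishes by `h1`, and its two iterated derivatives cancel by `h2`, `h3`, `h4`.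
  have h1 (Z W : 𝔬 n) : rescaledForm n (christoffel n Z W) W = 0 := by
    have h := rescaledForm_christoffel_skew Z W W
    rw [rescaledForm_apply, rescaledForm_apply, rescaledInner_comm W] at h
    rw [rescaledForm_apply]
    linarith
  have h2 : rescaledForm n (christoffel n X (christoffel n Y X)) X
      = -rescaledForm n (christoffel n Y X) (christoffel n X X) :=
    rescaledForm_christoffel_skew _ _ _
  have h3 : rescaledForm n (christoffel n Y (christoffel n X X)) X
      = -rescaledForm n (christoffel n X X) (christoffel n Y X) :=
    rescaledForm_christoffel_skew _ _ _
  have h4 : rescaledForm n (christoffel n X X) (christoffel n Y X)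
      = rescaledForm n (christoffel n Y X) (christoffel n X X) := rescaledInner_comm _ _
  have h5 := h1 ⁅X, Y⁆ X
  simp only [curvatureNumerator, lie_sub, lie_smul, lie_self, map_sub, map_smul,
    LinearMap.sub_apply, LinearMap.smul_apply, smul_eq_mul, smul_zero, sub_zero]
  rw [h2, h3, h4, h5]
  ring

lemma rescaledForm_θ {n : ℕ} (X Y : 𝔬 n) : rescaledForm n (θ X) (θ Y) = rescaledForm n X Y := by
  have h := LieAlgebra.killingForm_of_equiv_apply (R := ℝ) (θEquiv n) X (θ Y)
  rw [θEquiv_apply, θEquiv_apply] at h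
  simp only [rescaledForm_apply, rescaledInner, canonicalInner, h]

/-- θ is an isometry, so its eigenspaces for $1$ and $-1$ are orthogonal. -/
lemma rescaledForm_eq_zero {n : ℕ} {X Y : 𝔬 n} (hX : θ X = X) (hY : θ Y = -Y) :
    rescaledForm n X Y = 0 := by
  have h := rescaledForm_θ X Y
  rw [hX, hY, map_neg] at h
  linarith

lemma rescaledForm_lie {n : ℕ} (X Y Z : 𝔬 n) :
    rescaledForm n ⁅X, Y⁆ Z = -rescaledForm n Y ⁅θ X, Z⁆ := rescaledInner_lie X Y Z

lemma rescaledForm_comm {n : ℕ} (X Y : 𝔬 n) : rescaledForm n X Y = rescaledForm n Y X :=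
  rescaledInner_comm X Y

/-- The signs of θ on the components give $\nabla_AB=\frac12[A,B]$, $\nabla_PQ=\frac12[P,Q]$,
$\nabla_AQ=\frac32[A,Q]$ and $\nabla_PB=\frac12[B,P]$. The grouping separates the two eigenspaces.
-/
lemma christoffel_cartan {n : ℕ} {A P B Q : 𝔬 n} (hA : θ A = A) (hP : θ P = -P) (hB : θ B = B)
    (hQ : θ Q = -Q) :
    christoffel n (A + P) (B + Q)
      = (1 / 2 : ℝ) • (⁅A, B⁆ + ⁅P, Q⁆) + ((3 / 2 : ℝ) • ⁅A, Q⁆ + (1 / 2 : ℝ) • ⁅B, P⁆) := by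
  have h1 : θ (A + P) = A - P := by
    rw [← θEquiv_apply, map_add, θEquiv_apply, θEquiv_apply, hA, hP, sub_eq_add_neg]
  have h2 : θ (B + Q) = B - Q := by
    rw [← θEquiv_apply, map_add, θEquiv_apply, θEquiv_apply, hB, hQ, sub_eq_add_neg]
  rw [christoffel_apply, h1, h2]
  simp only [lie_add, add_lie, sub_lie]
  rw [← lie_skew A B, ← lie_skew P Q, ← lie_skew Q A, ← lie_skew P B]
  module

lemma curvatureNumerator_cartan {n : ℕ} {A P B Q : 𝔬 n} (hA : θ A = A) (hP : θ P = -P)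
    (hB : θ B = B) (hQ : θ Q = -Q) :
    curvatureNumerator (A + P) (B + Q) =
      1 / 4 * rescaledForm n ⁅A, B⁆ ⁅A, B⁆ - 7 / 4 * rescaledForm n ⁅P, Q⁆ ⁅P, Q⁆
      + 1 / 4 * rescaledForm n ⁅A, Q⁆ ⁅A, Q⁆ + 1 / 4 * rescaledForm n ⁅B, P⁆ ⁅B, P⁆
      + 2 * rescaledForm n ⁅A, Q⁆ ⁅B, P⁆ - 5 / 2 * rescaledForm n ⁅A, P⁆ ⁅B, Q⁆ := by
  have hk {S T : 𝔬 n} (hS : θ S = S) (hT : θ T = T) : θ ⁅S, T⁆ = ⁅S, T⁆ := by rw [θ_lie, hS, hT]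
  have hp {S T : 𝔬 n} (hS : θ S = S) (hT : θ T = -T) : θ ⁅S, T⁆ = -⁅S, T⁆ := by
    rw [θ_lie, hS, hT, lie_neg]
  have hpp {S T : 𝔬 n} (hS : θ S = -S) (hT : θ T = -T) : θ ⁅S, T⁆ = ⁅S, T⁆ := by
    rw [θ_lie, hS, hT, lie_neg, neg_lie, neg_neg]
  have θadd (S T : 𝔬 n) : θ (S + T) = θ S + θ T := (θEquiv n).toLinearMap.map_add S T
  have θsub (S T : 𝔬 n) : θ (S - T) = θ S - θ T := (θEquiv n).toLinearMap.map_sub S T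
  set c := ⁅A, B⁆ with hc
  set w := ⁅P, Q⁆ with hw
  set u := ⁅A, Q⁆ with hu
  set v := ⁅B, P⁆ with hv
  have θc : θ c = c := hk hA hB
  have θw : θ w = w := hpp hP hQ
  have θu : θ u = -u := hp hA hQ
  have θv : θ v = -v := hp hB hP
  have hcw : θ (c + w) = c + w := by rw [θadd, θc, θw]
  have huv : θ (u - v) = -(u - v) := by rw [θsub, θu, θv]; abel
  have e1 : christoffel n (A + P) (A + P) = (2 : ℝ) • ⁅A, P⁆ := by
    rw [christoffel_cartan hA hP hA hP, lie_self, lie_self]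
    module
  have e2 : christoffel n (B + Q) (B + Q) = (2 : ℝ) • ⁅B, Q⁆ := by
    rw [christoffel_cartan hB hQ hB hQ, lie_self, lie_self]
    module
  have e3 : christoffel n (A + P) (B + Q)
      = (1 / 2 : ℝ) • (c + w) + ((3 / 2 : ℝ) • u + (1 / 2 : ℝ) • v) :=
    christoffel_cartan hA hP hB hQ
  have e4 : christoffel n (B + Q) (A + P)
      = -(1 / 2 : ℝ) • (c + w) + ((3 / 2 : ℝ) • v + (1 / 2 : ℝ) • u) := by
    rw [christoffel_cartan hB hQ hA hP, ← lie_skew B A, ← lie_skew Q P]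
    module
  have e5 : ⁅A + P, B + Q⁆ = (c + w) + (u - v) := by
    rw [hv, add_lie, lie_add, lie_add, ← lie_skew P B, ← hc, ← hw, ← hu]
    abel
  have e6 : christoffel n ⁅A + P, B + Q⁆ (B + Q)
      = (1 / 2 : ℝ) • (⁅c + w, B⁆ + ⁅u - v, Q⁆)
        + ((3 / 2 : ℝ) • ⁅c + w, Q⁆ + (1 / 2 : ℝ) • ⁅B, u - v⁆) := by
    rw [e5, christoffel_cartan hcw huv hB hQ]
  -- `f1` to `f4` use that ad of a θ-fixed element is skew and ad of a θ-negated element is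
  -- symmetric. `z1` to `z8` are orthogonality of the eigenspaces.
  have f1 : rescaledForm n ⁅c + w, B⁆ A = -rescaledForm n (c + w) c := by
    rw [← lie_skew, map_neg, LinearMap.neg_apply, rescaledForm_lie, hB, ← lie_skew B A, map_neg]
    ring
  have f2 : rescaledForm n ⁅u - v, Q⁆ A = rescaledForm n (u - v) u := by
    rw [← lie_skew, map_neg, LinearMap.neg_apply, rescaledForm_lie, hQ, neg_lie, lie_skew]
    ring
  have f3 : rescaledForm n ⁅c + w, Q⁆ P = rescaledForm n (c + w) w := by
    rw [← lie_skew, map_neg, LinearMap.neg_apply, rescaledForm_lie, hQ, neg_lie, lie_skew]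
    ring
  have f4 : rescaledForm n ⁅B, u - v⁆ P = -rescaledForm n (u - v) v := by
    rw [rescaledForm_lie, hB]
  have z1 : rescaledForm n ⁅c + w, B⁆ P = 0 := rescaledForm_eq_zero (hk hcw hB) hP
  have z2 : rescaledForm n ⁅u - v, Q⁆ P = 0 := rescaledForm_eq_zero (hpp huv hQ) hP
  have z3 : rescaledForm n ⁅c + w, Q⁆ A = 0 := by
    rw [rescaledForm_comm]; exact rescaledForm_eq_zero hA (hp hcw hQ)
  have z4 : rescaledForm n ⁅B, u - v⁆ A = 0 := by
    rw [rescaledForm_comm]; exact rescaledForm_eq_zero hA (hp hB huv)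
  have z5 := rescaledForm_eq_zero θc θu
  have z6 := rescaledForm_eq_zero θc θv
  have z7 := rescaledForm_eq_zero θw θu
  have z8 := rescaledForm_eq_zero θw θv
  -- The Jacobi identity for $[P,[A,B]]$, paired with $Q$, eliminates the cross term
  -- $\langle[A,B],[P,Q]\rangle$. It enters with coefficient $-\frac32$.
  have jac : rescaledForm n c w = rescaledForm n u v - rescaledForm n ⁅A, P⁆ ⁅B, Q⁆ := by
    have g1 : rescaledForm n c w = rescaledForm n ⁅P, c⁆ Q := by
      rw [rescaledForm_comm c w, rescaledForm_lie P Q c, hP, neg_lie, map_neg, neg_neg,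
        rescaledForm_comm]
    have g2 : ⁅P, c⁆ = ⁅B, ⁅A, P⁆⁆ - ⁅A, v⁆ := by
      rw [hc, hv, leibniz_lie P A B, ← lie_skew P A, ← lie_skew P B, neg_lie, lie_neg,
        ← lie_skew B ⁅A, P⁆]
      abel
    rw [g1, g2, map_sub, LinearMap.sub_apply, rescaledForm_lie B ⁅A, P⁆ Q,
      rescaledForm_lie A v Q, hA, hB, ← hu, rescaledForm_comm v]
    ring
  rw [curvatureNumerator_eq, e1, e2, e3, e4, e6]
  simp only [map_add, map_smul, LinearMap.add_apply, LinearMap.smul_apply, smul_eq_mul, f1, f2, f3,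
    f4, z1, z2, z3, z4, z5, z6, z7, z8, rescaledForm_comm u c, rescaledForm_comm v c,
    rescaledForm_comm u w, rescaledForm_comm v w, map_sub, LinearMap.sub_apply,
    rescaledForm_comm v u, rescaledForm_comm w c, jac, rescaledForm_comm ⁅B, Q⁆]
  ring

/-! ### Estimates for the curvature and the final bound. -/

/-- The commutator bound controls the square by $64|A|^2|P|^2|B|^2|Q|^2$, and AM–GM gives
$|A|^2|P|^2\le x^2/4$ and $|B|^2|Q|^2\le y^2/4$. The hypothesis `h` admits any distribution of the
four components between the brackets, which serves both mixed terms. -/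
lemma rescaledForm_lie_lie_le {n : ℕ} (hn : 2 ≤ n) {A P B Q : 𝔬 n} {x y : ℝ}
    (hx : rescaledInner A A + rescaledInner P P = x) (hy : rescaledInner B B + rescaledInner Q Q = y)
    {S T S' T' : 𝔬 n}
    (h : rescaledInner S S * rescaledInner T T * (rescaledInner S' S' * rescaledInner T' T')
      = rescaledInner A A * rescaledInner P P * (rescaledInner B B * rescaledInner Q Q)) :
    |rescaledForm n ⁅S, T⁆ ⁅S', T'⁆| ≤ 2 * (x * y) := by
  have a0 := rescaledInner_self_nonneg hn A
  have p0 := rescaledInner_self_nonneg hn P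
  have b0 := rescaledInner_self_nonneg hn B
  have q0 := rescaledInner_self_nonneg hn Q
  have am {s t z : ℝ} (h : s + t = z) : s * t ≤ z ^ 2 / 4 := by
    rw [← h]; linarith [sq_nonneg (s - t)]
  refine abs_le_of_sq_le_sq ?_ (by rw [← hx, ← hy]; positivity)
  calc rescaledForm n ⁅S, T⁆ ⁅S', T'⁆ ^ 2
      ≤ rescaledInner ⁅S, T⁆ ⁅S, T⁆ * rescaledInner ⁅S', T'⁆ ⁅S', T'⁆ := rescaledInner_sq_le hn _ _
    _ ≤ (8 * (rescaledInner S S * rescaledInner T T))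
        * (8 * (rescaledInner S' S' * rescaledInner T' T')) :=
      mul_le_mul (rescaledInner_lie_self_le hn _ _) (rescaledInner_lie_self_le hn _ _)
        (rescaledInner_self_nonneg hn _) (by
          have := rescaledInner_self_nonneg hn S
          have := rescaledInner_self_nonneg hn T
          positivity)
    _ = 64 * (rescaledInner A A * rescaledInner P P * (rescaledInner B B * rescaledInner Q Q)) := by
      rw [← h]; ring
    _ ≤ 64 * (x ^ 2 / 4 * (y ^ 2 / 4)) := by
      gcongr
      · exact am hx
      · exact am hy
    _ = (2 * (x * y)) ^ 2 := by ring

lemma curvatureNumerator_le {n : ℕ} (hn : 2 ≤ n) (X Y : 𝔬 n) :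
    curvatureNumerator X Y ≤ 11 * (rescaledInner X X * rescaledInner Y Y) := by
  have cartan (Z : 𝔬 n) : ∃ A P : 𝔬 n, θ A = A ∧ θ P = -P ∧ Z = A + P ∧
      rescaledInner A A + rescaledInner P P = rescaledInner Z Z := by
    have h1 : θ ((1 / 2 : ℝ) • (Z + θ Z)) = (1 / 2 : ℝ) • (Z + θ Z) := by
      rw [← θEquiv_apply, map_smul, map_add, ← θEquiv_apply, θEquiv_apply, θEquiv_apply, θ_θ,
        add_comm]
    have h2 : θ ((1 / 2 : ℝ) • (Z - θ Z)) = -((1 / 2 : ℝ) • (Z - θ Z)) := by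
      rw [← θEquiv_apply, map_smul, map_sub, ← θEquiv_apply, θEquiv_apply, θEquiv_apply, θ_θ,
        ← smul_neg, neg_sub]
    have h3 : Z = (1 / 2 : ℝ) • (Z + θ Z) + (1 / 2 : ℝ) • (Z - θ Z) := by module
    refine ⟨_, _, h1, h2, h3, ?_⟩
    have h4 := rescaledForm_eq_zero h1 h2
    have h5 {S T : 𝔬 n} (h : rescaledForm n S T = 0) :
        rescaledInner S S + rescaledInner T T = rescaledInner (S + T) (S + T) := by
      have h' := rescaledForm_comm S T
      simp only [← rescaledForm_apply, map_add, LinearMap.add_apply]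
      linarith
    rw [h5 h4, ← h3]
  obtain ⟨A, P, hA, hP, rfl, hx⟩ := cartan X
  obtain ⟨B, Q, hB, hQ, rfl, hy⟩ := cartan Y
  have a0 := rescaledInner_self_nonneg hn A
  have p0 := rescaledInner_self_nonneg hn P
  have b0 := rescaledInner_self_nonneg hn B
  have q0 := rescaledInner_self_nonneg hn Q
  have i1 := rescaledInner_lie_self_le hn A B
  have i2 := rescaledInner_self_nonneg hn ⁅P, Q⁆
  have i3 := rescaledInner_lie_self_le hn A Q
  have i4 := rescaledInner_lie_self_le hn B P
  have i5 := (abs_le.1 (rescaledForm_lie_lie_le hn hx hy (S := A) (T := Q) (S' := B) (T' := P)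
    (by ring))).2
  have i6 := (abs_le.1 (rescaledForm_lie_lie_le hn hx hy (S := A) (T := P) (S' := B) (T' := Q)
    rfl)).1
  have i7 : rescaledInner A A * rescaledInner B B + rescaledInner A A * rescaledInner Q Q
      + rescaledInner B B * rescaledInner P P
      ≤ rescaledInner (A + P) (A + P) * rescaledInner (B + Q) (B + Q) := by
    rw [← hx, ← hy]
    linarith [mul_nonneg p0 q0]
  -- The three positive squares give $\frac14\cdot8=2$ by `i7`, and the mixed terms give $2\cdot2=4$
  -- and $\frac52\cdot2=5$, in total $11$.
  rw [curvatureNumerator_cartan hA hP hB hQ]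
  simp only [rescaledForm_apply] at i5 i6 ⊢
  linarith

theorem sectionalCurvature_le {n : ℕ} (hn : 2 ≤ n) {C : AffineConnection n} (hC : C.IsLeviCivita)
    (g : O n) {X Y : 𝔬 n} (hXY : LinearIndependent ℝ ![X, Y]) :
    C.sectionalCurvature (leftInvariant X) (leftInvariant Y) g ≤ ((n : ℝ) ^ 2 + 43 * n) / 8 := by
  rw [sectionalCurvature_leftInvariant hn hC]
  have hX : X ≠ 0 := hXY.ne_zero 0
  have hn' : (2 : ℝ) ≤ n := by exact_mod_cast hn
  have hbound : (11 : ℝ) ≤ ((n : ℝ) ^ 2 + 43 * n) / 8 := by nlinarith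
  have hxpos : 0 < rescaledInner X X :=
    (rescaledInner_self_nonneg hn X).lt_of_ne fun h => hX (eq_zero_of_rescaledInner_self hn h.symm)
  -- Gram–Schmidt coefficient: `Y - c • X` is orthogonal to `X`, so the Gram determinant factors as
  -- a product of two squared norms.
  set c : ℝ := rescaledInner X Y / rescaledInner X X with hc
  have hY : Y - c • X ≠ 0 := by
    intro h
    have h' := LinearIndependent.pair_iff.1 hXY (-c) 1 (by rw [← h]; module)
    exact one_ne_zero h'.2
  have hypos : 0 < rescaledInner (Y - c • X) (Y - c • X) :=
    (rescaledInner_self_nonneg hn _).lt_of_ne fun h => hY (eq_zero_of_rescaledInner_self hn h.symm)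
  have hgram : rescaledInner X X * rescaledInner (Y - c • X) (Y - c • X)
      = rescaledInner X X * rescaledInner Y Y - rescaledInner X Y ^ 2 := by
    have h : rescaledInner (Y - c • X) (Y - c • X)
        = rescaledInner Y Y - 2 * c * rescaledInner X Y + c ^ 2 * rescaledInner X X := by
      simp only [← rescaledForm_apply, map_sub, map_smul, LinearMap.sub_apply,
        LinearMap.smul_apply, smul_eq_mul, rescaledForm_comm Y X]
      ring
    rw [h, hc]
    field_simp
    ring
  rw [← hgram, div_le_iff₀ (mul_pos hxpos hypos), ← curvatureNumerator_sub_smul X Y c]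
  exact (curvatureNumerator_le hn _ _).trans
    (mul_le_mul_of_nonneg_right hbound (mul_pos hxpos hypos).le)

end Lorentz

theorem mainTheorem6 (n : ℕ) (hn : 2 ≤ n) (C : Lorentz.AffineConnection n)
    (hC : C.IsLeviCivita) (g : Lorentz.O n) (X Y : Lorentz.𝔬 n)
    (hXY : LinearIndependent ℝ ![X, Y]) :
    C.sectionalCurvature (Lorentz.leftInvariant X) (Lorentz.leftInvariant Y) g ≤
      ((n : ℝ) ^ 2 + 43 * n) / 8 := by
  exact Lorentz.sectionalCurvature_le hn hC g hXY
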